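/- **Proposition (small value probability).** Let $\alpha>0$, $\rho\ge 0$, let $\pi$ be a measure on $(0,\infty)$ with $\int_{(0,\infty)}(y\wedge y^2)\,\pi(dy)<\infty$, and let $$\psi(z)=-\alpha z+\rho z^2+\int_{(0,\infty)}\bigl(e^{-zy}-1+zy\bigr)\,\pi(dy),\qquad z\ge 0.$$ Let $\{(Y_t)_{t\ge 0};(\mathbf P_x)_{x\ge 0}\}$ be a (supercritical) continuous-state branching process with branching mechanism $\psi$, that is, a $[0,\infty)$-valued Hunt process such that $$\mathbf P_x\bigl[e^{-\lambda Y_t}\bigr]=e^{-x v_t(\lambda)},\qquad x,t,\lambda\ge 0,$$ where, for each $\lambda\ge 0$, $t\mapsto v_t(\lambda)$ is the unique non-negative continuous solution of $$v_t(\lambda)+\int_0^t\psi(v_s(\lambda))\,ds=\lambda,\qquad t\ge 0.$$ Suppose that Grey's condition holds, i.e. there exists $z'>0$ such that $\psi(z)>0$ for all $z>z'$ and $\int_{z'}^\infty\psi(z)^{-1}\,dz<\infty$, and that the $L\log L$ condition $\int_{(1,\infty)}y\log y\,\pi(dy)<\infty$ holds. Set $W_t=e^{-\alpha t}Y_t$.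 Let $t\mapsto k_t$ be a strictly positive function on $[0,\infty)$ such that $k_t\to 0$ and $k_te^{\alpha t}\to\infty$ as $t\to\infty$. Then, for each $x\ge 0$, there exist constants $C,\delta>0$ such that $$\mathbf P_x(0<W_t\le k_t)\le C\bigl(k_t^{\delta}+e^{-\delta t}\bigr)\qquad\text{for all } t\ge 0.$$ -/

import Mathlib

open MeasureTheory Filter Topology
open scoped NNReal ENNReal

noncomputable section

/-- The data of a supercritical branching mechanism: `α > 0`, `ρ ≥ 0` and a measure `π` carried by
`(0, ∞)` with `∫ (y ∧ y²) π(dy) < ∞`. -/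
structure BranchingMechanism where
  α : ℝ
  ρ : ℝ
  π : Measure ℝ
  α_pos : 0 < α
  ρ_nonneg : 0 ≤ ρ
  π_Iic : π (Set.Iic 0) = 0
  lintegral_min_lt_top : ∫⁻ y in Set.Ioi 0, ENNReal.ofReal (min y (y ^ 2)) ∂π < ∞

namespace BranchingMechanism

/-- `ψ(z) = -α z + ρ z² + ∫_{(0,∞)} (e^{-zy} - 1 + zy) π(dy)`, used for `z ≥ 0` only. -/
def eval (ψ : BranchingMechanism) (z : ℝ) : ℝ :=
  -ψ.α * z + ψ.ρ * z ^ 2 + ∫ y in Set.Ioi 0, (Real.exp (-z * y) - 1 + z * y) ∂ψ.π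

/-- Grey's condition. -/
def Grey (ψ : BranchingMechanism) : Prop :=
  ∃ z' : ℝ, 0 < z' ∧ (∀ z, z' < z → 0 < ψ.eval z) ∧
    IntegrableOn (fun z => (ψ.eval z)⁻¹) (Set.Ioi z')

/-- The `L log L` condition `∫_{(1,∞)} y log y π(dy) < ∞`. -/
def LLogL (ψ : BranchingMechanism) : Prop :=
  IntegrableOn (fun y => y * Real.log y) (Set.Ioi 1) ψ.π

/-- `v : [0, ∞) → [0, ∞)` is a (continuous) solution of
`v_t + ∫_0^t ψ(v_s) ds = l`, `t ≥ 0`. Values of `v` at negative times play no role. -/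
structure IsCumulant (ψ : BranchingMechanism) (l : ℝ) (v : ℝ → ℝ) : Prop where
  continuousOn : ContinuousOn v (Set.Ici 0)
  nonneg : ∀ t, 0 ≤ t → 0 ≤ v t
  equation : ∀ t, 0 ≤ t → v t + ∫ s in (0 : ℝ)..t, ψ.eval (v s) = l

end BranchingMechanism

/-- A (conservative) Hunt process `((X_t)_{t ≥ 0}; (P_x)_{x ∈ E})` on `Ω`: a normal strong Markov
process with respect to a right-continuous filtration, with right-continuous paths having left
limits, which is quasi-left continuous. -/
structure HuntProcess (E Ω : Type*) [TopologicalSpace E] [MeasurableSpace E]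
    [mΩ : MeasurableSpace Ω] where
  /-- the law `P_x` of the process started at `x` -/
  P : E → Measure Ω
  /-- the filtration -/
  𝓕 : Filtration ℝ≥0 mΩ
  /-- the process -/
  X : ℝ≥0 → Ω → E
  isProbabilityMeasure : ∀ x, IsProbabilityMeasure (P x)
  measurable_transition : ∀ (t : ℝ≥0) (B : Set E), MeasurableSet B →
    Measurable fun x => P x (X t ⁻¹' B)
  isRightContinuous : 𝓕.IsRightContinuous
  adapted : Adapted 𝓕 X
  normal : ∀ x, ∀ᵐ ω ∂(P x), X 0 ω = x
  right_continuous : ∀ ω t, ContinuousWithinAt (fun s => X s ω) (Set.Ici t) t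
  left_limits : ∀ x, ∀ᵐ ω ∂(P x), ∀ t, 0 < t → ∃ l, Tendsto (fun s => X s ω) (𝓝[<] t) (𝓝 l)
  /-- `P_x(A ∩ {τ < ∞} ∩ {X_{τ+t} ∈ B}) = P_x[P_{X_τ}(X_t ∈ B); A ∩ {τ < ∞}]` for `A ∈ 𝓕_τ`. -/
  strong_markov : ∀ (τ : Ω → WithTop ℝ≥0) (hτ : IsStoppingTime 𝓕 τ) (x : E) (t : ℝ≥0)
    (A : Set Ω) (B : Set E), MeasurableSet[hτ.measurableSpace] A → MeasurableSet B →
    P x (A ∩ {ω | τ ω ≠ ⊤} ∩ {ω | X ((τ ω).untopA + t) ω ∈ B}) =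
      ∫⁻ ω in A ∩ {ω | τ ω ≠ ⊤}, P (stoppedValue X τ ω) (X t ⁻¹' B) ∂(P x)
  /-- `X_{τ_n} → X_τ` a.s. on `{τ < ∞}` whenever the stopping times `τ_n` increase to `τ`. -/
  quasi_left_continuous : ∀ (τn : ℕ → Ω → WithTop ℝ≥0) (τ : Ω → WithTop ℝ≥0),
    (∀ n, IsStoppingTime 𝓕 (τn n)) → (∀ ω, Monotone fun n => τn n ω) →
    (∀ ω, IsLUB (Set.range fun n => τn n ω) (τ ω)) →
    ∀ x, ∀ᵐ ω ∂(P x), τ ω ≠ ⊤ →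
      Tendsto (fun n => stoppedValue X (τn n) ω) atTop (𝓝 (stoppedValue X τ ω))

/-- The `[0, ∞)`-valued Hunt process `Y` is a continuous-state branching process with branching
mechanism `ψ`: `P_x[e^{-l Y_t}] = e^{-x v_t(l)}` for all `x, t, l ≥ 0`, where `v_·(l)` is the
solution of the cumulant equation started at `l`. -/
def IsCSBP {Ω : Type*} [MeasurableSpace Ω] (ψ : BranchingMechanism)
    (Y : HuntProcess ℝ≥0 Ω) : Prop :=
  ∀ l : ℝ≥0, ∃ v : ℝ → ℝ, ψ.IsCumulant l v ∧
    ∀ x t : ℝ≥0, ∫ ω, Real.exp (-(l * Y.X t ω : ℝ)) ∂(Y.P x) = Real.exp (-(x * v t : ℝ))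

/-- `W_t = e^{-αt} Y_t`. -/
def normalizedProcess {Ω : Type*} [MeasurableSpace Ω] (ψ : BranchingMechanism)
    (Y : HuntProcess ℝ≥0 Ω) (t : ℝ≥0) (ω : Ω) : ℝ :=
  Real.exp (-ψ.α * t) * Y.X t ω

end

/-! Chernoff: on the event, `c Y_t ≤ 1` with `c = e^{-αt}/k_t`, so its probability is at most `e
(E[e^{-c Y_t}] - P(Y_t = 0))`, where `P(Y_t = 0)` is the limit of `E[e^{-n Y_t}]`. By the branching
formula it remains to show that `v_t(c)` is not far below, and `v_t(n)` not far above, a positive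
root `r` of `ψ`.

From above: under Grey's condition `v(n)` falls below a level `M` by a time independent of `n`
(`Grey.exists_le`); convexity of `ψ` then gives exponential attraction to `r`, with error of order
`e^{-δt}`.

From below: write `c = e^{-αs}`. The `L log L` condition says that `α + ψ(z)/z` is integrable along
`z = e^{-αu}`, so linear growth at rate `α` brings `v(c)` to order one by time `s`
(`exp_neg_integral_logRate_le`). The remaining time `t - s = -log k_t / α` brings it exponentially
close to `r`, with error of order `k_t^{δ/α}`. -/

lemma exp_neg_sub_one_add_nonneg (u : ℝ) : 0 ≤ Real.exp (-u) - 1 + u := by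
  linarith [Real.add_one_le_exp (-u)]

lemma exp_neg_sub_one_add_le_self {u : ℝ} (hu : 0 ≤ u) : Real.exp (-u) - 1 + u ≤ u := by
  linarith [Real.exp_le_one_iff.2 (neg_nonpos.2 hu)]

lemma exp_neg_sub_one_add_le_sq {u : ℝ} (hu : 0 ≤ u) : Real.exp (-u) - 1 + u ≤ u ^ 2 := by
  have h1 : Real.exp (-u) ≤ (u + 1)⁻¹ := by
    rw [Real.exp_neg]
    exact inv_anti₀ (by linarith) (Real.add_one_le_exp u)
  have h2 : (u + 1)⁻¹ ≤ 1 - u + u ^ 2 := by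
    rw [inv_le_iff_one_le_mul₀ (by linarith)]
    nlinarith [pow_nonneg hu 3]
  linarith

/-! ### Integrability, convexity and continuity of the mechanism -/

namespace BranchingMechanism

variable (ψ : BranchingMechanism)

lemma integrableOn_min : IntegrableOn (fun y : ℝ => min y (y ^ 2)) (Set.Ioi 0) ψ.π := by
  refine ⟨by fun_prop, ?_⟩
  rw [hasFiniteIntegral_iff_ofReal]
  · exact ψ.lintegral_min_lt_top
  · filter_upwards [ae_restrict_mem measurableSet_Ioi] with y hy
    exact le_min (le_of_lt hy) (sq_nonneg y)

/-- Weighting `π` by the positive function `y ∧ y²` makes it finite. Needed for Fubini, as `π` is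
not assumed σ-finite. -/
lemma sFinite_restrict : SFinite (ψ.π.restrict (Set.Ioi 0)) := by
  set f : ℝ → ℝ≥0∞ := fun y => ENNReal.ofReal (min y (y ^ 2))
  have hf : Measurable f := by fun_prop
  have h := withDensity_inv_same (μ := ψ.π.restrict (Set.Ioi 0)) hf
    (by
      filter_upwards [ae_restrict_mem measurableSet_Ioi] with y hy
      have hy' : (0 : ℝ) < y := hy
      simp only [f, ne_eq, ENNReal.ofReal_eq_zero, not_le]
      positivity)
    (Eventually.of_forall fun y => ENNReal.ofReal_ne_top)
  have : IsFiniteMeasure ((ψ.π.restrict (Set.Ioi 0)).withDensity f) :=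
    isFiniteMeasure_withDensity ψ.lintegral_min_lt_top.ne
  rw [← h]
  infer_instance

/-- The jump part `∫ (e^{-zy} - 1 + zy) π(dy)` of the branching mechanism. -/
noncomputable def jumpPart (z : ℝ) : ℝ := ∫ y in Set.Ioi 0, (Real.exp (-z * y) - 1 + z * y) ∂ψ.π

lemma eval_eq (z : ℝ) : ψ.eval z = -ψ.α * z + ψ.ρ * z ^ 2 + ψ.jumpPart z := rfl

lemma integrableOn_jump {z : ℝ} (hz : 0 ≤ z) :
    IntegrableOn (fun y => Real.exp (-z * y) - 1 + z * y) (Set.Ioi 0) ψ.π := by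
  refine (ψ.integrableOn_min.const_mul (z + z ^ 2)).mono' (by fun_prop) ?_
  filter_upwards [ae_restrict_mem measurableSet_Ioi] with y hy
  have hy' : (0 : ℝ) < y := hy
  have hzy : 0 ≤ z * y := by positivity
  rw [neg_mul, Real.norm_of_nonneg (exp_neg_sub_one_add_nonneg _)]
  rcases min_choice y (y ^ 2) with h | h <;> rw [h]
  · nlinarith [exp_neg_sub_one_add_le_self hzy, mul_nonneg (sq_nonneg z) hy'.le]
  · nlinarith [exp_neg_sub_one_add_le_sq hzy, mul_nonneg hz (sq_nonneg y)]

lemma jumpPart_nonneg (z : ℝ) : 0 ≤ ψ.jumpPart z :=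
  integral_nonneg fun y => by
    have := exp_neg_sub_one_add_nonneg (z * y)
    simpa [neg_mul] using this

lemma jumpPart_zero : ψ.jumpPart 0 = 0 := by simp [jumpPart]

lemma eval_zero : ψ.eval 0 = 0 := by simp [eval_eq, jumpPart_zero]

lemma neg_mul_le_eval (z : ℝ) : -ψ.α * z ≤ ψ.eval z := by
  rw [eval_eq]
  nlinarith [ψ.jumpPart_nonneg z, mul_nonneg ψ.ρ_nonneg (sq_nonneg z)]

lemma convexOn_jumpPart : ConvexOn ℝ (Set.Ici 0) ψ.jumpPart := by
  refine ⟨convex_Ici 0, fun x hx y hy a b ha hb hab => ?_⟩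
  have hx' : (0 : ℝ) ≤ x := hx
  have hy' : (0 : ℝ) ≤ y := hy
  have ix := (ψ.integrableOn_jump hx').const_mul a
  have iy := (ψ.integrableOn_jump hy').const_mul b
  simp only [smul_eq_mul, jumpPart]
  rw [← integral_const_mul, ← integral_const_mul, ← integral_add ix iy]
  refine integral_mono (ψ.integrableOn_jump (by positivity)) (ix.add iy) fun u => ?_
  have h := convexOn_exp.2 (Set.mem_univ (-x * u)) (Set.mem_univ (-y * u)) ha hb hab
  simp only [smul_eq_mul] at h
  have e : -(a * x + b * y) * u = a * (-x * u) + b * (-y * u) := by ring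
  simp only [e]
  nlinarith

lemma convexOn_eval : ConvexOn ℝ (Set.Ici 0) ψ.eval := by
  refine ⟨convex_Ici 0, fun x hx y hy a b ha hb hab => ?_⟩
  have h1 := ψ.convexOn_jumpPart.2 hx hy ha hb hab
  have h2 := (convexOn_pow 2).2 hx hy ha hb hab
  simp only [smul_eq_mul, eval_eq] at *
  nlinarith [mul_le_mul_of_nonneg_left h2 ψ.ρ_nonneg]

/-- Convexity and `ψ(0) = 0` make `ψ(z)/z` nondecreasing. -/
lemma eval_le_mul_eval_div {b z : ℝ} (hb : 0 ≤ b) (hz : 0 < z) (hbz : b ≤ z) :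
    ψ.eval b ≤ b * (ψ.eval z / z) := by
  have hbz' : b / z ≤ 1 := (div_le_one hz).2 hbz
  have h := ψ.convexOn_eval.2 (Set.mem_Ici.2 hz.le) (Set.mem_Ici.2 le_rfl)
    (div_nonneg hb hz.le) (sub_nonneg.2 hbz') (by ring)
  simp only [smul_eq_mul, eval_zero, mul_zero, add_zero, div_mul_cancel₀ _ hz.ne'] at h
  calc _ ≤ _ := h
    _ = _ := by ring

lemma continuousOn_eval_Ioi : ContinuousOn ψ.eval (Set.Ioi 0) :=
  (ψ.convexOn_eval.subset Set.Ioi_subset_Ici_self (convex_Ioi 0)).continuousOn isOpen_Ioi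

lemma continuousOn_eval : ContinuousOn ψ.eval (Set.Ici 0) := by
  intro z hz
  rcases eq_or_lt_of_le (show (0 : ℝ) ≤ z from hz) with rfl | hz
  · rw [ContinuousWithinAt, eval_zero]
    refine tendsto_of_tendsto_of_tendsto_of_le_of_le' (g := fun z => -ψ.α * z)
      (h := fun z => z * (ψ.eval 1 / 1)) ?_ ?_ (Eventually.of_forall ψ.neg_mul_le_eval) ?_
    · exact ((by fun_prop : Continuous fun z : ℝ => -ψ.α * z).tendsto' 0 0 (by simp)).mono_left
        nhdsWithin_le_nhds
    · exact ((by fun_prop : Continuous fun z : ℝ => z * (ψ.eval 1 / 1)).tendsto' 0 0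
        (by simp)).mono_left nhdsWithin_le_nhds
    · filter_upwards [self_mem_nhdsWithin,
        nhdsWithin_le_nhds (Iic_mem_nhds (zero_lt_one' ℝ))] with b hb hb1
      exact ψ.eval_le_mul_eval_div hb one_pos hb1
  · exact ((ψ.continuousOn_eval_Ioi.continuousAt (Ioi_mem_nhds hz))).continuousWithinAt

lemma continuous_eval_exp (s : ℝ) (c : ℝ) :
    Continuous fun q : ℝ => ψ.eval (Real.exp (c * (s - q))) :=
  ψ.continuousOn_eval_Ioi.comp_continuous (by fun_prop) fun _ => Real.exp_pos _

/-! ### The `L log L` condition as integrability of the growth defect -/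

/-- `∫_0^∞ (e^{-e^{-αu} y} - 1 + e^{-αu} y) e^{αu} du` is at most of order `y log y`. -/
lemma integral_jump_div_exp_le {a y : ℝ} (ha : 0 < a) (hy : 0 < y) :
    IntegrableOn (fun u => (Real.exp (-Real.exp (-a * u) * y) - 1 + Real.exp (-a * u) * y) /
      Real.exp (-a * u)) (Set.Ioi 0) ∧
    ∫ u in Set.Ioi 0, (Real.exp (-Real.exp (-a * u) * y) - 1 + Real.exp (-a * u) * y) /
      Real.exp (-a * u) ≤
      (min y (y ^ 2) + (Set.Ioi 1).indicator (fun y => y * Real.log y) y) / a := by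
  set F : ℝ → ℝ := fun u => (Real.exp (-Real.exp (-a * u) * y) - 1 + Real.exp (-a * u) * y) /
      Real.exp (-a * u)
  have hF0 : ∀ u, 0 ≤ F u := fun u => by
    simp only [F, neg_mul _ y]
    exact div_nonneg (exp_neg_sub_one_add_nonneg _) (Real.exp_pos _).le
  have hF1 : ∀ u, F u ≤ y := fun u => by
    simp only [F, neg_mul _ y]
    rw [div_le_iff₀ (Real.exp_pos _), mul_comm y]
    exact exp_neg_sub_one_add_le_self (by positivity)
  have hF2 : ∀ u, F u ≤ y ^ 2 * Real.exp (-a * u) := fun u => by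
    simp only [F, neg_mul _ y]
    rw [div_le_iff₀ (Real.exp_pos _)]
    refine (exp_neg_sub_one_add_le_sq (by positivity)).trans_eq (by ring)
  have hFc : Continuous F := by
    refine Continuous.div (by fun_prop) (by fun_prop) fun u => (Real.exp_pos _).ne'
  have hEi : ∀ c, IntegrableOn (fun u => y ^ 2 * Real.exp (-a * u)) (Set.Ioi c) := fun c =>
    (exp_neg_integrableOn_Ioi c ha).const_mul _
  have hFi : ∀ c, IntegrableOn F (Set.Ioi c) := fun c =>
    (hEi c).mono' hFc.aestronglyMeasurable
      (Eventually.of_forall fun u => by rw [Real.norm_of_nonneg (hF0 u)]; exact hF2 u)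
  have hE : ∀ c, ∫ u in Set.Ioi c, F u ≤ y ^ 2 * Real.exp (-a * c) / a := fun c => by
    calc ∫ u in Set.Ioi c, F u ≤ ∫ u in Set.Ioi c, y ^ 2 * Real.exp (-a * u) :=
          integral_mono (hFi c) (hEi c) hF2
      _ = _ := by
          rw [integral_const_mul, integral_exp_mul_Ioi (by linarith)]
          field_simp
  refine ⟨hFi 0, ?_⟩
  rcases le_or_gt y 1 with h1 | h1
  · rw [Set.indicator_of_notMem (by simpa using h1), min_eq_right (by nlinarith), add_zero]
    simpa using hE 0
  · rw [Set.indicator_of_mem (by simpa using h1), min_eq_left (by nlinarith)]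
    have hl : 0 < Real.log y := Real.log_pos h1
    -- Split where `e^{-au} y = 1`: the bound `F ≤ y` before that time yields the `y log y`, the
    -- quadratic bound after it yields `y`.
    have hc : 0 ≤ Real.log y / a := by positivity
    rw [← Set.Ioc_union_Ioi_eq_Ioi hc, setIntegral_union
      (Set.Ioc_disjoint_Ioi le_rfl) measurableSet_Ioi
      ((hFi 0).mono_set Set.Ioc_subset_Ioi_self) (hFi _)]
    have e1 : ∫ u in Set.Ioc 0 (Real.log y / a), F u ≤ y * (Real.log y / a) := by
      calc _ ≤ ∫ u in Set.Ioc 0 (Real.log y / a), y :=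
            integral_mono ((hFi 0).mono_set Set.Ioc_subset_Ioi_self) (by simp) hF1
        _ = _ := by simp [hc, mul_comm]
    have e2 := hE (Real.log y / a)
    have e3 : Real.exp (-a * (Real.log y / a)) = y⁻¹ := by
      rw [show -a * (Real.log y / a) = -Real.log y by field_simp, Real.exp_neg, Real.exp_log hy]
    rw [e3, show y ^ 2 * y⁻¹ = y by field_simp] at e2
    calc _ ≤ _ := add_le_add e1 e2
      _ = _ := by ring

lemma integrableOn_jumpPart_div_exp (h : ψ.LLogL) :
    IntegrableOn (fun u => ψ.jumpPart (Real.exp (-ψ.α * u)) / Real.exp (-ψ.α * u))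
      (Set.Ioi 0) := by
  have := ψ.sFinite_restrict
  set F : ℝ × ℝ → ℝ := fun p => (Real.exp (-Real.exp (-ψ.α * p.1) * p.2) - 1 +
    Real.exp (-ψ.α * p.1) * p.2) / Real.exp (-ψ.α * p.1)
  have hFm : Continuous F :=
    Continuous.div (by fun_prop) (by fun_prop) fun u => (Real.exp_pos _).ne'
  have hF0 : ∀ p, 0 ≤ F p := fun p => by
    simp only [F, neg_mul _ p.2]
    exact div_nonneg (exp_neg_sub_one_add_nonneg _) (Real.exp_pos _).le
  have hF : Integrable F ((volume.restrict (Set.Ioi 0)).prod (ψ.π.restrict (Set.Ioi 0))) := by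
    rw [integrable_prod_iff' hFm.aestronglyMeasurable]
    have hlog : Integrable ((Set.Ioi 1).indicator fun y => y * Real.log y)
        (ψ.π.restrict (Set.Ioi 0)) :=
      ((integrable_indicator_iff measurableSet_Ioi).2 h).restrict
    constructor
    · filter_upwards [ae_restrict_mem measurableSet_Ioi] with y hy
      exact (integral_jump_div_exp_le ψ.α_pos hy).1
    · refine ((ψ.integrableOn_min.add hlog).div_const ψ.α).mono'
        (AEStronglyMeasurable.integral_prod_right' (f := fun p : ℝ × ℝ => ‖F (p.2, p.1)‖)
          (by fun_prop)) ?_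
      filter_upwards [ae_restrict_mem measurableSet_Ioi] with y hy
      simp only [Real.norm_of_nonneg (hF0 _)]
      rw [Real.norm_of_nonneg (integral_nonneg fun _ => hF0 _)]
      exact (integral_jump_div_exp_le ψ.α_pos hy).2
  refine hF.integral_prod_left.congr (Eventually.of_forall fun u => ?_)
  simp only [F, jumpPart]
  rw [integral_div]

/-- A majorant of `α + ψ(z) / z` along `z = e^{-αu}`, with a strictly positive surplus. -/
noncomputable def logRate (u : ℝ) : ℝ :=
  ψ.α + ψ.eval (Real.exp (-ψ.α * u)) / Real.exp (-ψ.α * u) + Real.exp (-ψ.α * u)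

lemma logRate_eq (u : ℝ) : ψ.logRate u = (ψ.ρ + 1) * Real.exp (-ψ.α * u) +
    ψ.jumpPart (Real.exp (-ψ.α * u)) / Real.exp (-ψ.α * u) := by
  have := Real.exp_pos (-ψ.α * u)
  rw [logRate, eval_eq]
  field_simp
  ring

lemma logRate_nonneg (u : ℝ) : 0 ≤ ψ.logRate u := by
  rw [logRate_eq]
  have := ψ.ρ_nonneg
  have := ψ.jumpPart_nonneg (Real.exp (-ψ.α * u))
  positivity

lemma continuous_logRate : Continuous ψ.logRate := by
  have h := ψ.continuous_eval_exp 0 ψ.α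
  have e : ψ.logRate = fun u => ψ.α + ψ.eval (Real.exp (ψ.α * (0 - u))) /
      Real.exp (-ψ.α * u) + Real.exp (-ψ.α * u) := by
    ext u
    rw [logRate, show ψ.α * (0 - u) = -ψ.α * u by ring]
  rw [e]
  exact (continuous_const.add (h.div (by fun_prop) fun _ => (Real.exp_pos _).ne')).add
    (by fun_prop)

lemma integrableOn_logRate (h : ψ.LLogL) : IntegrableOn ψ.logRate (Set.Ioi 0) := by
  have e : ψ.logRate = _ := funext ψ.logRate_eq
  rw [e]
  exact ((exp_neg_integrableOn_Ioi 0 ψ.α_pos).const_mul _).add (ψ.integrableOn_jumpPart_div_exp h)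

/-! ### Positive root and chord bounds -/

/-- Otherwise `logRate` would be at least `α` everywhere, hence not integrable. -/
lemma exists_eval_neg (h : ψ.LLogL) : ∃ z, 0 < z ∧ ψ.eval z < 0 := by
  by_contra! hc
  have hge : ∀ u, ψ.α ≤ ψ.logRate u := fun u => by
    have := div_nonneg (hc _ (Real.exp_pos (-ψ.α * u))) (Real.exp_pos (-ψ.α * u)).le
    have := Real.exp_pos (-ψ.α * u)
    rw [logRate]
    linarith
  have : IntegrableOn (fun _ : ℝ => ψ.α) (Set.Ioi 0) :=
    (ψ.integrableOn_logRate h).mono' (by fun_prop)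
      (Eventually.of_forall fun u => by rw [Real.norm_of_nonneg ψ.α_pos.le]; exact hge u)
  rw [integrableOn_const_iff] at this
  simp [ψ.α_pos.ne'] at this

lemma exists_root (h : ψ.LLogL) (hG : ψ.Grey) :
    ∃ z₀ l, 0 < z₀ ∧ z₀ < l ∧ ψ.eval l = 0 ∧ ∀ z, 0 < z → z ≤ z₀ → ψ.eval z < 0 := by
  obtain ⟨z₀, hz₀, hneg⟩ := ψ.exists_eval_neg h
  obtain ⟨z', hz', hpos, -⟩ := hG
  set b := max z' z₀ + 1
  have hb : z' < b := (le_max_left _ _).trans_lt (lt_add_one _)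
  have hb₀ : z₀ < b := (le_max_right _ _).trans_lt (lt_add_one _)
  obtain ⟨l, hl, hl0⟩ := intermediate_value_Icc hb₀.le
    (ψ.continuousOn_eval.mono (Set.Icc_subset_Ici_self.trans (Set.Ici_subset_Ici.2 hz₀.le)))
    (show (0 : ℝ) ∈ Set.Icc (ψ.eval z₀) (ψ.eval b) from ⟨hneg.le, (hpos b hb).le⟩)
  refine ⟨z₀, l, hz₀, lt_of_le_of_ne hl.1 ?_, hl0, fun z hz hzz => ?_⟩
  · rintro rfl
    exact hneg.ne hl0
  · exact (ψ.eval_le_mul_eval_div hz.le hz₀ hzz).trans_lt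
      (mul_neg_of_pos_of_neg hz (div_neg_of_neg_of_pos hneg hz₀))

/-- The chord from `(c, ψ(c))` to `(l, 0)` lies above `ψ`; in the next lemma its extension past `l`
lies below. When `ψ(c) < 0`, its slope bounds the rate of attraction to `l` from either side. -/
lemma eval_le_chord {c l z : ℝ} (hc : 0 ≤ c) (hcl : c < l) (hl : ψ.eval l = 0) (h1 : c ≤ z)
    (h2 : z ≤ l) : ψ.eval z ≤ ψ.eval c / (l - c) * (l - z) := by
  have hd : 0 < l - c := sub_pos.2 hcl
  have h := ψ.convexOn_eval.2 (Set.mem_Ici.2 hc) (Set.mem_Ici.2 (hc.trans hcl.le))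
    (div_nonneg (sub_nonneg.2 h2) hd.le) (div_nonneg (sub_nonneg.2 h1) hd.le)
    (by field_simp; ring)
  simp only [smul_eq_mul, hl, mul_zero, add_zero] at h
  rw [show (l - z) / (l - c) * c + (z - c) / (l - c) * l = z by field_simp; ring] at h
  exact h.trans_eq (by ring)

lemma chord_le_eval {c l z : ℝ} (hc : 0 ≤ c) (hcl : c < l) (hl : ψ.eval l = 0) (h : l ≤ z) :
    -ψ.eval c / (l - c) * (z - l) ≤ ψ.eval z := by
  have hd : 0 < l - c := sub_pos.2 hcl
  have hz : 0 < z - c := by linarith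
  have h := ψ.convexOn_eval.2 (Set.mem_Ici.2 hc) (Set.mem_Ici.2 (hc.trans (hcl.le.trans h)))
    (div_nonneg (sub_nonneg.2 h) hz.le) (div_nonneg hd.le hz.le)
    (by field_simp; ring)
  simp only [smul_eq_mul] at h
  rw [show (z - l) / (z - c) * c + (l - c) / (z - c) * z = l by field_simp; ring, hl,
    div_mul_eq_mul_div, div_mul_eq_mul_div, ← add_div] at h
  have h' : 0 ≤ (z - l) * ψ.eval c + (l - c) * ψ.eval z := by
    by_contra! hlt
    exact absurd h (not_le.2 (div_neg_of_neg_of_pos hlt hz))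
  rw [div_mul_eq_mul_div, div_le_iff₀ hd]
  linarith

end BranchingMechanism

/-! ### Comparison for the cumulant equation -/

namespace BranchingMechanism

namespace IsCumulant

variable {ψ : BranchingMechanism} {l : ℝ} {v : ℝ → ℝ}

lemma hasDerivWithinAt (hv : ψ.IsCumulant l v) {t : ℝ} (ht : 0 ≤ t) :
    HasDerivWithinAt v (-ψ.eval (v t)) (Set.Ici t) t := by
  -- Freezing `v` at negative times makes the integrand continuous on the whole line.
  have hc : Continuous fun s => ψ.eval (v (max s 0)) :=
    ψ.continuousOn_eval.comp_continuous
      (hv.continuousOn.comp_continuous (by fun_prop) fun s => le_max_right s 0)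
      fun s => hv.nonneg _ (le_max_right s 0)
  have hd := ((hc.integral_hasStrictDerivAt 0 t).hasDerivAt.const_sub l).hasDerivWithinAt
    (s := Set.Ici t)
  have he : ∀ s, 0 ≤ s → v s = l - ∫ r in (0 : ℝ)..s, ψ.eval (v (max r 0)) := fun s hs => by
    rw [intervalIntegral.integral_congr (g := fun r => ψ.eval (v r)), ← hv.equation s hs]
    · ring
    · intro r hr
      rw [Set.uIcc_of_le hs] at hr
      simp only [max_eq_left hr.1]
  rw [max_eq_left ht] at hd
  exact hd.congr (fun s hs => he s (ht.trans hs)) (he t ht)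

lemma apply_zero (hv : ψ.IsCumulant l v) : v 0 = l := by
  simpa using hv.equation 0 le_rfl

lemma continuousOn_Icc (hv : ψ.IsCumulant l v) {a : ℝ} (ha : 0 ≤ a) (b : ℝ) :
    ContinuousOn v (Set.Icc a b) :=
  hv.continuousOn.mono fun _ hs => ha.trans hs.1

lemma barrier_le (hv : ψ.IsCumulant l v) {a b : ℝ} (ha : 0 ≤ a) (hab : a ≤ b) {B B' : ℝ → ℝ}
    (hB : ∀ r, HasDerivAt B (B' r) r) (h0 : B a ≤ v a)
    (h : ∀ r, a ≤ r → r < b → B r = v r → B' r < -ψ.eval (B r)) : B b ≤ v b :=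
  image_le_of_deriv_right_lt_deriv_boundary'
    (fun _ _ => (hB _).continuousAt.continuousWithinAt) (fun _ _ => (hB _).hasDerivWithinAt) h0
    (hv.continuousOn_Icc ha b) (fun _ hr => hv.hasDerivWithinAt (ha.trans hr.1))
    (fun _ hr he => he ▸ h _ hr.1 hr.2 he) ⟨hab, le_rfl⟩

lemma le_barrier (hv : ψ.IsCumulant l v) {a b : ℝ} (ha : 0 ≤ a) (hab : a ≤ b) {B B' : ℝ → ℝ}
    (hB : ∀ r, HasDerivAt B (B' r) r) (h0 : v a ≤ B a)
    (h : ∀ r, a ≤ r → r < b → -ψ.eval (B r) < B' r) : v b ≤ B b :=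
  image_le_of_deriv_right_lt_deriv_boundary' (hv.continuousOn_Icc ha b)
    (fun _ hr => hv.hasDerivWithinAt (ha.trans hr.1)) h0
    (fun _ _ => (hB _).continuousAt.continuousWithinAt) (fun _ _ => (hB _).hasDerivWithinAt)
    (fun _ hr he => he ▸ h _ hr.1 hr.2) ⟨hab, le_rfl⟩

/-- Under the `L log L` condition, the cumulant started at `e^{-αs}` is of order one at time `s`. -/
lemma exp_neg_integral_logRate_le {s : ℝ} (hs : 0 ≤ s) (hv : ψ.IsCumulant (Real.exp (-ψ.α * s)) v)
    (h : ψ.LLogL) : Real.exp (-∫ u in Set.Ioi 0, ψ.logRate u) ≤ v s := by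
  set I : ℝ → ℝ := fun r => ∫ q in (0 : ℝ)..r, ψ.logRate (s - q)
  have hc : Continuous fun q => ψ.logRate (s - q) := ψ.continuous_logRate.comp (by fun_prop)
  have hI : ∀ r, HasDerivAt I (ψ.logRate (s - r)) r := fun r =>
    (hc.integral_hasStrictDerivAt 0 r).hasDerivAt
  -- The barrier is the linear solution `z = e^{-α(s-r)}` damped by `e^{-I}`. As it stays below `z`,
  -- `ψ(B) ≤ B ψ(z)/z`; the surplus `z` in `logRate` makes the differential inequality strict.
  have key := hv.barrier_le le_rfl hs
    (B := fun r => Real.exp (-ψ.α * (s - r) - I r))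
    (B' := fun r => Real.exp (-ψ.α * (s - r) - I r) * (ψ.α - ψ.logRate (s - r)))
    (fun r => by
      refine (((((hasDerivAt_id r).const_sub s).const_mul (-ψ.α)).sub (hI r)).exp).congr_deriv ?_
      simp)
    (by simp [I, hv.apply_zero])
    (fun r hr hrs _ => by
      have hI0 : 0 ≤ I r := intervalIntegral.integral_nonneg hr fun q _ => ψ.logRate_nonneg _
      have hz := Real.exp_pos (-ψ.α * (s - r))
      have hb := Real.exp_pos (-ψ.α * (s - r) - I r)
      have hbz := ψ.eval_le_mul_eval_div hb.le hz (Real.exp_le_exp.2 (by linarith))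
      simp only [logRate]
      nlinarith [mul_pos hb hz])
  refine le_trans (Real.exp_le_exp.2 ?_) key
  have e : I s ≤ ∫ u in Set.Ioi 0, ψ.logRate u := by
    simp only [I]
    rw [intervalIntegral.integral_comp_sub_left, sub_self, sub_zero,
      intervalIntegral.integral_of_le hs]
    exact setIntegral_mono_set (ψ.integrableOn_logRate h)
      (Eventually.of_forall ψ.logRate_nonneg) Set.Ioc_subset_Ioi_self.eventuallyLE
  simpa using e

/-- A cumulant converges to the positive root of `ψ` exponentially fast from below. -/
lemma sub_exp_le (hv : ψ.IsCumulant l v) {c r δ s t : ℝ} (hc : 0 ≤ c) (hcr : c < r)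
    (hr : ψ.eval r = 0) (hδ : 0 < δ) (hδ' : δ < -ψ.eval c / (r - c)) (hs : 0 ≤ s) (hst : s ≤ t)
    (hcs : c ≤ v s) : r - r * Real.exp (-δ * (t - s)) ≤ v t := by
  have key := hv.barrier_le hs hst
    (B := fun q => r - (r - c) * Real.exp (-δ * (q - s)))
    (B' := fun q => (r - c) * Real.exp (-δ * (q - s)) * δ)
    (fun q => by
      refine (((((hasDerivAt_id q).sub_const s).const_mul (-δ)).exp.const_mul (r - c)).const_sub
        r).congr_deriv ?_
      simp only [id]
      ring)
    (by simpa using hcs)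
    (fun q hq _ _ => by
      have he := Real.exp_pos (-δ * (q - s))
      have he1 : Real.exp (-δ * (q - s)) ≤ 1 := Real.exp_le_one_iff.2 (by nlinarith)
      have hd : 0 < r - c := sub_pos.2 hcr
      have := ψ.eval_le_chord hc hcr hr (z := r - (r - c) * Real.exp (-δ * (q - s)))
        (by nlinarith) (by nlinarith)
      rw [sub_sub_cancel] at this
      have h2 := mul_lt_mul_of_pos_left hδ' (mul_pos hd he)
      rw [neg_div] at h2
      nlinarith)
  refine le_trans ?_ key
  nlinarith [Real.exp_pos (-δ * (t - s))]

/-- A cumulant converges to the positive root of `ψ` exponentially fast from above. -/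
lemma le_add_exp (hv : ψ.IsCumulant l v) {c r δ M s t : ℝ} (hc : 0 ≤ c) (hcr : c < r)
    (hr : ψ.eval r = 0) (hδ' : δ < -ψ.eval c / (r - c)) (hM : 0 < M)
    (hs : 0 ≤ s) (hst : s ≤ t) (hcs : v s ≤ M) : v t ≤ r + M * Real.exp (-δ * (t - s)) := by
  refine hv.le_barrier hs hst
    (B := fun q => r + M * Real.exp (-δ * (q - s)))
    (B' := fun q => -(M * Real.exp (-δ * (q - s)) * δ))
    (fun q => by
      refine (((((hasDerivAt_id q).sub_const s).const_mul (-δ)).exp.const_mul M).const_add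
        r).congr_deriv ?_
      simp only [id]
      ring)
    (by simp; linarith)
    (fun q hq _ => by
      have he := mul_pos hM (Real.exp_pos (-δ * (q - s)))
      have := ψ.chord_le_eval hc hcr hr (z := r + M * Real.exp (-δ * (q - s))) (by linarith)
      rw [add_sub_cancel_left] at this
      have h2 := mul_lt_mul_of_pos_left hδ' he
      nlinarith)

end IsCumulant

/-- Under Grey's condition, cumulants come down from infinity. -/
lemma Grey.exists_le {ψ : BranchingMechanism} (h : ψ.Grey) :
    ∃ M T : ℝ, 0 < M ∧ 0 ≤ T ∧ ∀ (l : ℝ) (v : ℝ → ℝ), ψ.IsCumulant l v →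
      ∃ s, 0 ≤ s ∧ s ≤ T ∧ v s ≤ M := by
  obtain ⟨z', hz', hpos, hint⟩ := h
  set M := z' + 1
  have hM : z' < M := lt_add_one z'
  set J := ∫ z in Set.Ioi z', (ψ.eval z)⁻¹
  have hJ : 0 ≤ J := setIntegral_nonneg measurableSet_Ioi fun z hz => (inv_pos.2 (hpos z hz)).le
  refine ⟨M, J + 1, by linarith, by linarith, fun l v hv => ?_⟩
  by_contra! hcon
  have hcont : ContinuousOn (fun z => (ψ.eval z)⁻¹) (Set.Ioi z') :=
    (ψ.continuousOn_eval_Ioi.mono (Set.Ioi_subset_Ioi hz'.le)).inv₀ fun z hz => (hpos z hz).ne'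
  set F : ℝ → ℝ := fun z => ∫ u in M..z, (ψ.eval u)⁻¹
  have hF : ∀ z, M < z → HasDerivAt F (ψ.eval z)⁻¹ z := fun z hz => by
    refine intervalIntegral.integral_hasDerivAt_right ?_
      (hcont.stronglyMeasurableAtFilter isOpen_Ioi _ (hM.trans hz))
      (hcont.continuousAt (Ioi_mem_nhds (hM.trans hz)))
    refine (hcont.mono fun u hu => ?_).intervalIntegrable
    rw [Set.uIcc_of_le hz.le] at hu
    exact hM.trans_le hu.1
  have hvM : ∀ s ∈ Set.Icc 0 (J + 1), M < v s := fun s hs => hcon s hs.1 hs.2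
  -- Separation of variables: while `v > M`, `F(v_s) + s` is constant. Since `F(v_0) ≤ J` and `F ≥
  -- 0` there, this cannot last until time `J + 1`.
  have hconst := constant_of_has_deriv_right_zero (f := fun s => F (v s) + s) (a := 0) (b := J + 1)
    (ContinuousOn.add (fun s hs => (hF _ (hvM s hs)).continuousAt.comp_continuousWithinAt
      (hv.continuousOn_Icc le_rfl _ s hs)) continuousOn_id)
    (fun s hs => by
      have hs' := hvM s (Set.Ico_subset_Icc_self hs)
      refine (((hF _ hs').comp_hasDerivWithinAt s (hv.hasDerivWithinAt hs.1)).add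
        (hasDerivWithinAt_id s _)).congr_deriv ?_
      have := hpos _ (hM.trans hs')
      field_simp
      ring)
    (J + 1) ⟨by linarith, le_rfl⟩
  have h1 : 0 ≤ F (v (J + 1)) :=
    intervalIntegral.integral_nonneg (hvM _ ⟨by linarith, le_rfl⟩).le
      fun u hu => (inv_pos.2 (hpos u (hM.trans_le hu.1))).le
  have h2 : F (v 0) ≤ J := by
    simp only [F]
    rw [intervalIntegral.integral_of_le (hvM 0 ⟨le_rfl, by linarith⟩).le]
    refine setIntegral_mono_set hint ?_
      (Set.Ioc_subset_Ioi_self.trans (Set.Ioi_subset_Ioi hM.le)).eventuallyLE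
    filter_upwards [ae_restrict_mem measurableSet_Ioi] with z hz
    exact (inv_pos.2 (hpos z hz)).le
  linarith

end BranchingMechanism

/-! ### From cumulants to probabilities -/

lemma exp_neg_mul_sub_exp_neg_mul_le {x u v r a b : ℝ} (hx : 0 ≤ x) (hv : 0 ≤ v)
    (ha : 0 ≤ a) (hb : 0 ≤ b) (hu : u ≤ r + a) (hv' : r - b ≤ v) :
    Real.exp (-(x * v)) - Real.exp (-(x * u)) ≤ x * (a + b) := by
  rcases le_or_gt u v with h | h
  · have : Real.exp (-(x * v)) ≤ Real.exp (-(x * u)) := Real.exp_le_exp.2 (by nlinarith)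
    have : 0 ≤ x * (a + b) := by positivity
    linarith
  · have h1 : Real.exp (-(x * v)) ≤ 1 :=
      Real.exp_le_one_iff.2 (neg_nonpos.2 (mul_nonneg hx hv))
    have h2 : Real.exp (-(x * u)) = Real.exp (-(x * v)) * Real.exp (-(x * (u - v))) := by
      rw [← Real.exp_add]
      ring_nf
    have h3 := Real.add_one_le_exp (-(x * (u - v)))
    have h4 : x * (u - v) ≤ x * (a + b) := mul_le_mul_of_nonneg_left (by linarith) hx
    have h5 : 0 ≤ x * (u - v) := mul_nonneg hx (by linarith)
    rw [h2]
    nlinarith [Real.exp_pos (-(x * v))]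

/-- A Chernoff bound for the probability that a nonnegative variable is small but nonzero. -/
lemma measureReal_pos_and_mul_le_one_le {Ω : Type*} [MeasurableSpace Ω] (μ : Measure Ω)
    [IsProbabilityMeasure μ] {X : Ω → ℝ≥0} (hX : Measurable X) {c B : ℝ} (hc : 0 ≤ c)
    (h : ∀ n : ℕ, ∫ ω, Real.exp (-(c * X ω)) ∂μ - ∫ ω, Real.exp (-(n * X ω)) ∂μ ≤ B) :
    μ.real {ω | 0 < X ω ∧ c * X ω ≤ 1} ≤ Real.exp 1 * B := by
  have hexp : ∀ d : ℝ, 0 ≤ d → Integrable (fun ω => Real.exp (-(d * X ω))) μ := fun d hd =>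
    (integrable_const (1 : ℝ)).mono' (by fun_prop) (Eventually.of_forall fun ω => by
      rw [Real.norm_of_nonneg (Real.exp_pos _).le, Real.exp_le_one_iff]
      have := mul_nonneg hd (X ω).coe_nonneg
      linarith)
  have hS0 : MeasurableSet {ω | X ω = 0} := hX (measurableSet_singleton 0)
  have hS : MeasurableSet {ω | 0 < X ω ∧ c * X ω ≤ 1} :=
    (measurableSet_lt measurable_const hX).inter
      (measurableSet_le (hX.coe_nnreal_real.const_mul c) measurable_const)
  have hlim : Tendsto (fun n : ℕ => ∫ ω, Real.exp (-(n * X ω)) ∂μ) atTop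
      (𝓝 (∫ ω, {ω | X ω = 0}.indicator (fun _ => (1 : ℝ)) ω ∂μ)) := by
    refine tendsto_integral_of_dominated_convergence (fun _ => 1) (fun n => by fun_prop)
      (integrable_const _) (fun n => Eventually.of_forall fun ω => ?_)
      (Eventually.of_forall fun ω => ?_)
    · rw [Real.norm_of_nonneg (Real.exp_pos _).le, Real.exp_le_one_iff]
      have := mul_nonneg (Nat.cast_nonneg (α := ℝ) n) (X ω).coe_nonneg
      linarith
    · by_cases h0 : X ω = 0
      · simp [h0]
      · rw [Set.indicator_of_notMem (by simpa using h0)]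
        have hpos : (0 : ℝ) < X ω := NNReal.coe_pos.2 (pos_iff_ne_zero.2 h0)
        exact Real.tendsto_exp_neg_atTop_nhds_zero.comp
          (tendsto_natCast_atTop_atTop.atTop_mul_const hpos)
  have hB : ∫ ω, Real.exp (-(c * X ω)) ∂μ -
      ∫ ω, {ω | X ω = 0}.indicator (fun _ => (1 : ℝ)) ω ∂μ ≤ B :=
    le_of_tendsto (tendsto_const_nhds.sub hlim) (Eventually.of_forall h)
  have hi0 : Integrable ({ω | X ω = 0}.indicator fun _ => (1 : ℝ)) μ :=
    (integrable_const _).indicator hS0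
  rw [← integral_sub (hexp c hc) hi0] at hB
  refine le_trans ?_ (mul_le_mul_of_nonneg_left hB (Real.exp_pos 1).le)
  rw [← integral_indicator_one hS, ← integral_const_mul]
  refine integral_mono ((integrable_const _).indicator hS)
    (((hexp c hc).sub hi0).const_mul _) fun ω => ?_
  by_cases h0 : X ω = 0
  · simp [h0]
  · by_cases h1 : c * X ω ≤ 1
    · rw [Set.indicator_of_mem (show ω ∈ {ω | 0 < X ω ∧ c * X ω ≤ 1} from
        ⟨pos_iff_ne_zero.2 h0, h1⟩)]
      simp only [Set.indicator_of_notMem (show ω ∉ {ω | X ω = 0} from h0), sub_zero,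
        ← Real.exp_add, Pi.one_apply, Real.one_le_exp_iff]
      linarith
    · rw [Set.indicator_of_notMem fun hm => h1 hm.2]
      simp only [Set.indicator_of_notMem (show ω ∉ {ω | X ω = 0} from h0), sub_zero]
      positivity

/-- The two-sided rate of convergence of the cumulants to the positive root of `ψ`, turned into a
bound for the Laplace transforms of a branching process. -/
lemma IsCSBP.exists_laplace_sub_le {Ω : Type*} [MeasurableSpace Ω] {ψ : BranchingMechanism}
    {Y : HuntProcess ℝ≥0 Ω} (hY : IsCSBP ψ Y) (hGrey : ψ.Grey) (hLLogL : ψ.LLogL) :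
    ∃ A δ T : ℝ, 0 ≤ A ∧ 0 < δ ∧ 0 ≤ T ∧ ∀ (x t : ℝ≥0) (s : ℝ) (n : ℕ), T ≤ t → 0 ≤ s → s ≤ t →
      ∫ ω, Real.exp (-(Real.exp (-ψ.α * s) * Y.X t ω)) ∂(Y.P x) -
        ∫ ω, Real.exp (-(n * Y.X t ω)) ∂(Y.P x) ≤
        x * (A * Real.exp (-δ * t) + A * Real.exp (-δ * (t - s))) := by
  obtain ⟨z₀, r, hz₀, hz₀r, hr, hneg⟩ := ψ.exists_root hLLogL hGrey
  obtain ⟨M, T, hM, hT, hdown⟩ := hGrey.exists_le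
  -- Small enough for `ψ(c) < 0`, and below the level that `v` has reached at time `s`.
  set c := min z₀ (Real.exp (-∫ u in Set.Ioi 0, ψ.logRate u))
  have hc : 0 < c := lt_min hz₀ (Real.exp_pos _)
  have hcr : c < r := (min_le_left _ _).trans_lt hz₀r
  have hslope : 0 < -ψ.eval c / (r - c) :=
    div_pos (neg_pos.2 (hneg c hc (min_le_left _ _))) (sub_pos.2 hcr)
  obtain ⟨δ, hδ, hδ'⟩ := exists_between hslope
  have hr0 : 0 < r := hz₀.trans hz₀r
  refine ⟨max (M * Real.exp (δ * T)) r, δ, T, le_max_of_le_right hr0.le, hδ, hT,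
    fun x t s n hTt hs hst => ?_⟩
  obtain ⟨v, hv, hvY⟩ := hY ⟨Real.exp (-ψ.α * s), (Real.exp_pos _).le⟩
  obtain ⟨w, hw, hwY⟩ := hY n
  have e1 : ∫ ω, Real.exp (-(Real.exp (-ψ.α * s) * Y.X t ω)) ∂(Y.P x) = _ := hvY x t
  have e2 := hwY x t
  simp only [NNReal.coe_natCast] at e2
  rw [e1, e2]
  replace hv : ψ.IsCumulant (Real.exp (-ψ.α * s)) v := hv
  refine exp_neg_mul_sub_exp_neg_mul_le (r := r) x.coe_nonneg (hv.nonneg _ t.coe_nonneg)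
    (by positivity) (by positivity) ?_ ?_
  · obtain ⟨q, hq0, hqT, hq⟩ := hdown _ _ hw
    refine (hw.le_add_exp hc.le hcr hr hδ' hM hq0 (hqT.trans hTt) hq).trans ?_
    refine add_le_add le_rfl ?_
    calc M * Real.exp (-δ * (t - q)) ≤ M * (Real.exp (δ * T) * Real.exp (-δ * t)) := by
          rw [← Real.exp_add]
          gcongr
          nlinarith
      _ = M * Real.exp (δ * T) * Real.exp (-δ * t) := by ring
      _ ≤ _ := mul_le_mul_of_nonneg_right (le_max_left _ _) (Real.exp_pos _).le
  · refine le_trans ?_ (hv.sub_exp_le hc.le hcr hr hδ hδ' hs hst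
      ((min_le_right _ _).trans (hv.exp_neg_integral_logRate_le hs hLLogL)))
    gcongr
    exact le_max_right _ _

theorem mainTheorem5 {Ω : Type*} [MeasurableSpace Ω] (ψ : BranchingMechanism)
    (Y : HuntProcess ℝ≥0 Ω) (hY : IsCSBP ψ Y) (hGrey : ψ.Grey) (hLLogL : ψ.LLogL)
    (k : ℝ≥0 → ℝ) (hk_pos : ∀ t, 0 < k t) (hk_zero : Tendsto k atTop (𝓝 0))
    (hk_top : Tendsto (fun t : ℝ≥0 => k t * Real.exp (ψ.α * t)) atTop atTop) (x : ℝ≥0) :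
    ∃ C δ : ℝ, 0 < C ∧ 0 < δ ∧ ∀ t : ℝ≥0,
      (Y.P x).real {ω | 0 < normalizedProcess ψ Y t ω ∧ normalizedProcess ψ Y t ω ≤ k t} ≤
        C * (k t ^ δ + Real.exp (-δ * t)) := by
  have := Y.isProbabilityMeasure x
  have hα := ψ.α_pos
  obtain ⟨A, δ, T, hA, hδ, hT, hbound⟩ := hY.exists_laplace_sub_le hGrey hLLogL
  obtain ⟨T₀, hT₀⟩ := eventually_atTop.1 ((hk_zero.eventually_le_const one_pos).and
    ((hk_top.eventually_ge_atTop 1).and (eventually_ge_atTop (⟨T, hT⟩ : ℝ≥0))))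
  -- `δ` is the rate in `t`, `δ/α` the power of `k_t`; the second term of `C` below makes the bound
  -- trivial for `t < T₀`.
  set d := min δ (δ / ψ.α)
  have hd : 0 < d := lt_min hδ (by positivity)
  refine ⟨Real.exp 1 * (x * A) + Real.exp (d * T₀), d, by positivity, hd, fun t => ?_⟩
  have hkt := hk_pos t
  have hkd : 0 < k t ^ d := Real.rpow_pos_of_pos hkt d
  have hed := Real.exp_pos (-d * t)
  have hxA : 0 ≤ Real.exp 1 * (x * A) := by positivity
  rcases lt_or_ge t T₀ with ht | ht
  · have ht' : (t : ℝ) ≤ T₀ := by exact_mod_cast ht.le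
    have h1 : 1 ≤ Real.exp (d * T₀) * Real.exp (-d * t) := by
      rw [← Real.exp_add, Real.one_le_exp_iff]
      nlinarith
    refine measureReal_le_one.trans (h1.trans ?_)
    nlinarith [Real.exp_pos (d * T₀), mul_nonneg hxA (add_pos hkd hed).le,
      mul_pos (Real.exp_pos (d * T₀)) hkd]
  · obtain ⟨hk1, hktop, hTt⟩ := hT₀ t ht
    have hTt' : T ≤ t := by exact_mod_cast hTt
    -- Chosen so that `e^{-αs} = e^{-αt}/k_t`; `k_t ≤ 1` gives `s ≤ t`, and `k_t e^{αt} ≥ 1` gives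
    -- `s ≥ 0`.
    set s : ℝ := t + Real.log (k t) / ψ.α with hs_def
    have hlog : Real.log (k t) ≤ 0 := Real.log_nonpos hkt.le hk1
    have hst : s ≤ t := by
      have := div_nonpos_of_nonpos_of_nonneg hlog hα.le
      linarith
    have hαs : ψ.α * s = ψ.α * t + Real.log (k t) := by
      rw [hs_def]
      field_simp
    have hs : 0 ≤ s := by
      have h := Real.log_nonneg hktop
      rw [Real.log_mul hkt.ne' (Real.exp_pos _).ne', Real.log_exp] at h
      exact nonneg_of_mul_nonneg_right (by linarith) hα
    have hexp : Real.exp (-ψ.α * s) = Real.exp (-ψ.α * t) / k t := by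
      rw [neg_mul, hαs, neg_add, Real.exp_add, Real.exp_neg (Real.log _), Real.exp_log hkt, neg_mul,
        div_eq_mul_inv]
    have hrate : Real.exp (-δ * (t - s)) ≤ k t ^ d := by
      have e : -δ * (t - s) = Real.log (k t) * (δ / ψ.α) := by
        rw [hs_def]
        field_simp
        ring
      rw [e, ← Real.rpow_def_of_pos hkt]
      exact Real.rpow_le_rpow_of_exponent_ge hkt hk1 (min_le_right _ _)
    have hrate' : Real.exp (-δ * t) ≤ Real.exp (-d * t) := by
      have : d * t ≤ δ * t := mul_le_mul_of_nonneg_right (min_le_left _ _) t.coe_nonneg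
      exact Real.exp_le_exp.2 (by linarith)
    have hmeas : Measurable (Y.X t) := (Y.adapted t).mono (Y.𝓕.le t) le_rfl
    have hsub : {ω | 0 < normalizedProcess ψ Y t ω ∧ normalizedProcess ψ Y t ω ≤ k t} ⊆
        {ω | 0 < Y.X t ω ∧ Real.exp (-ψ.α * s) * Y.X t ω ≤ 1} := by
      rintro ω ⟨h1, h2⟩
      refine ⟨NNReal.coe_pos.1 (pos_of_mul_pos_right h1 (Real.exp_pos _).le), ?_⟩
      rw [hexp, div_mul_eq_mul_div, div_le_one hkt]
      exact h2
    calc _ ≤ _ := measureReal_mono hsub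
      _ ≤ _ := measureReal_pos_and_mul_le_one_le (Y.P x) hmeas (Real.exp_pos _).le
          fun n => hbound x t s n hTt' hs hst
      _ ≤ Real.exp 1 * (x * (A * Real.exp (-d * t) + A * k t ^ d)) := by gcongr
      _ = Real.exp 1 * (x * A) * (k t ^ d + Real.exp (-d * t)) := by ring
      _ ≤ _ := by
          gcongr
          exact le_add_of_nonneg_right (Real.exp_pos _).le
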